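/- Let $q$ be an even prime power, let $m\ge 6$ be an integer with $m\equiv 2\pmod 4$, and let $n=q^m+1$. For $0\le s\le n-1$ let $C_s=\{sq^i \bmod n : 0\le i\le l-1\}$ be the $q$-cyclotomic coset of $s$ modulo $n$, where $l$ is the multiplicative order of $q$ modulo $n$ and residues are taken in $\{0,\dots,n-1\}$. The coset leader of $C_s$ is its smallest element, and a coset leader modulo $n$ is the coset leader of some $C_s$ with $0\le s\le n-1$. Put $$\delta_2=\frac{q(q-1)(q^m-2q^{m-4}-1)}{2(q^2+1)},\qquad \delta_3=\begin{cases}\delta_2-(q-1)q^2, & m=6,\\ \delta_2-q(q-1)(q^2-1), & m>6.\end{cases}$$ Then $\delta_2$ and $\delta_3$ are non-negative integers, $\delta_2$ is the second largest and $\delta_3$ is the third largest coset leader modulo $n$, and $|C_{\delta_2}|=|C_{\delta_3}|=2m$. -/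

import Mathlib

/-- The `q`-cyclotomic coset `C_s = {s q^i mod n : 0 ≤ i ≤ l - 1}` modulo `n`, where `l` is the
multiplicative order of `q` modulo `n`. -/
noncomputable def cyclotomicCoset (q n s : ℕ) : Finset ℕ :=
  (Finset.range (orderOf (q : ZMod n))).image fun i => s * q ^ i % n

/-- The coset leader of `C_s`: its smallest element. -/
noncomputable def cosetLeader (q n s : ℕ) : ℕ :=
  sInf (cyclotomicCoset q n s : Set ℕ)

/-- The set of all coset leaders modulo `n`. -/
noncomputable def minRep (q n : ℕ) : Finset ℕ :=
  (Finset.range n).image (cosetLeader q n)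

/-- `a` is the `i`-th largest coset leader modulo `n` (counted from `i = 1`): it is a coset leader
and exactly `i - 1` coset leaders are larger. -/
def IsNthLargestCosetLeader (q n i a : ℕ) : Prop :=
  a ∈ minRep q n ∧ ((minRep q n).filter fun b => a < b).card + 1 = i

/-- Twice the distance from the centre of `[0, n]` to the residue of `s * q ^ i` modulo `n`. -/
def foldedOrbit (q n s i : ℕ) : ℤ := |2 * ((s * q ^ i % n : ℕ) : ℤ) - n|

lemma foldedOrbit_succ {q n s i : ℕ} (hq : Even q) (hn : 0 < n)
    (h : (q : ℤ) * foldedOrbit q n s i < 2 * n) :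
    foldedOrbit q n s (i + 1) = |(n : ℤ) - q * foldedOrbit q n s i| := by
  obtain ⟨r, rfl⟩ := hq
  unfold foldedOrbit at *
  have hstep : s * (r + r) ^ (i + 1) % n = (r + r) * (s * (r + r) ^ i % n) % n := by
    rw [pow_succ, Nat.mul_mod_mod]; congr 1; ring
  rw [hstep]
  generalize s * (r + r) ^ i % n = x at *
  have hx' : (r + r) * x % n < n := Nat.mod_lt _ hn
  have hdiv := Nat.div_add_mod ((r + r) * x) n
  generalize (r + r) * x % n = x' at *
  generalize (r + r) * x / n = d at *
  zify at hdiv hx' hn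
  push_cast at h ⊢
  have hx0 : (0 : ℤ) ≤ x' := by positivity
  have hr0 : (0 : ℤ) ≤ r := by positivity
  rcases le_total 0 (2 * (x : ℤ) - n) with hz | hz
  · rw [abs_of_nonneg hz] at h ⊢
    have h0 : 0 ≤ ((r : ℤ) + r) * (2 * x - n) := by positivity
    have hd : (d : ℤ) = r := by
      have h1 : (n : ℤ) * (d - r) < n * 1 := by nlinarith
      have h2 : (n : ℤ) * (-1) < n * (d - r) := by nlinarith
      have := lt_of_mul_lt_mul_left h1 hn.le
      have := lt_of_mul_lt_mul_left h2 hn.le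
      omega
    rw [abs_sub_comm (n : ℤ)]
    congr 1
    rw [hd] at hdiv
    linear_combination (2 : ℤ) * hdiv
  · rw [abs_of_nonpos hz] at h ⊢
    have h0 : ((r : ℤ) + r) * (2 * x - n) ≤ 0 := mul_nonpos_of_nonneg_of_nonpos (by positivity) hz
    rcases h0.lt_or_eq with h0 | h0
    · have hd : (d : ℤ) = r - 1 := by
        have h1 : (n : ℤ) * (d - r) < n * 0 := by nlinarith
        have h2 : (n : ℤ) * (-2) < n * (d - r) := by nlinarith
        have := lt_of_mul_lt_mul_left h1 hn.le
        have := lt_of_mul_lt_mul_left h2 hn.le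
        omega
      congr 1
      rw [hd] at hdiv
      linear_combination (2 : ℤ) * hdiv
    · have hd : (d : ℤ) = r := by
        have h1 : (n : ℤ) * (d - r) < n * 1 := by nlinarith
        have h2 : (n : ℤ) * (-1) < n * (d - r) := by nlinarith
        have := lt_of_mul_lt_mul_left h1 hn.le
        have := lt_of_mul_lt_mul_left h2 hn.le
        omega
      rw [hd] at hdiv
      have e1 : 2 * (x' : ℤ) - n = -n := by linear_combination (2 : ℤ) * hdiv + h0
      have e2 : (n : ℤ) - (r + r) * -(2 * x - n) = n := by linear_combination h0
      rw [e1, e2, abs_neg]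

lemma foldedOrbit_zero {q n s : ℕ} (hs : 2 * s ≤ n) (hn : 0 < n) :
    foldedOrbit q n s 0 = n - 2 * s := by
  unfold foldedOrbit
  rw [pow_zero, mul_one, Nat.mod_eq_of_lt (by omega), abs_of_nonpos (by omega)]
  ring

lemma mul_pow_add_mod {q m s : ℕ} (i : ℕ) :
    (s * q ^ (i + m) + s * q ^ i) % (q ^ m + 1) = 0 := by
  have : s * q ^ (i + m) + s * q ^ i = (q ^ m + 1) * (s * q ^ i) := by ring
  rw [this, Nat.mul_mod_right]

lemma foldedOrbit_add {q m s : ℕ} (i : ℕ) :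
    foldedOrbit q (q ^ m + 1) s (i + m) = foldedOrbit q (q ^ m + 1) s i := by
  have h := @mul_pow_add_mod q m s i
  unfold foldedOrbit
  rw [Nat.add_mod] at h
  have h1 : s * q ^ (i + m) % (q ^ m + 1) < q ^ m + 1 := Nat.mod_lt _ (by omega)
  have h2 : s * q ^ i % (q ^ m + 1) < q ^ m + 1 := Nat.mod_lt _ (by omega)
  generalize s * q ^ (i + m) % (q ^ m + 1) = a at *
  generalize s * q ^ i % (q ^ m + 1) = b at *
  obtain ⟨c, hc⟩ := Nat.dvd_of_mod_eq_zero h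
  have hc2 : c < 2 := by
    by_contra hcon
    have := Nat.mul_le_mul_left (q ^ m + 1) (not_lt.mp hcon)
    omega
  interval_cases c
  · have ha : a = 0 := by omega
    have hb : b = 0 := by omega
    rw [ha, hb]
  · rw [← abs_neg]
    congr 1
    push_cast
    push_cast [← @Nat.cast_inj ℤ] at hc
    linarith

lemma pow_two_mul_mod {q m n : ℕ} (hn : n = q ^ m + 1) : ((q : ZMod n)) ^ (2 * m) = 1 := by
  have h : ((q ^ m + 1 : ℕ) : ZMod n) = 0 := by rw [← hn]; exact ZMod.natCast_self n
  push_cast at h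
  rw [mul_comm, pow_mul, eq_neg_of_add_eq_zero_left h]
  ring

lemma mem_cyclotomicCoset {q m n s a : ℕ} (hm : 0 < m) (hn : n = q ^ m + 1) :
    a ∈ cyclotomicCoset q n s ↔ ∃ i, s * q ^ i % n = a := by
  have hfin : 0 < orderOf (q : ZMod n) :=
    orderOf_pos_iff.mpr (isOfFinOrder_iff_pow_eq_one.mpr ⟨2 * m, by omega, pow_two_mul_mod hn⟩)
  unfold cyclotomicCoset
  simp only [Finset.mem_image, Finset.mem_range]
  constructor
  · rintro ⟨i, _, h⟩; exact ⟨i, h⟩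
  · rintro ⟨i, h⟩
    refine ⟨i % orderOf (q : ZMod n), Nat.mod_lt _ hfin, ?_⟩
    rw [← h]
    have : ((s * q ^ (i % orderOf (q : ZMod n)) : ℕ) : ZMod n) = ((s * q ^ i : ℕ) : ZMod n) := by
      push_cast
      rw [pow_mod_orderOf]
    exact (ZMod.natCast_eq_natCast_iff _ _ _).mp this

lemma mem_minRep {q m n s : ℕ} (hm : 0 < m) (hn : n = q ^ m + 1) :
    s ∈ minRep q n ↔ s < n ∧ ∀ i, s ≤ s * q ^ i % n := by
  have hne : ∀ t, ((cyclotomicCoset q n t : Set ℕ)).Nonempty := fun t =>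
    ⟨t * q ^ 0 % n, Finset.mem_coe.mpr ((mem_cyclotomicCoset hm hn).mpr ⟨0, rfl⟩)⟩
  have hn0 : 0 < n := by omega
  unfold minRep cosetLeader
  simp only [Finset.mem_image, Finset.mem_range]
  constructor
  · rintro ⟨t, ht, rfl⟩
    have hmem := Nat.sInf_mem (hne t)
    rw [Finset.mem_coe, mem_cyclotomicCoset hm hn] at hmem
    obtain ⟨j, hj⟩ := hmem
    refine ⟨by rw [← hj]; exact Nat.mod_lt _ hn0, fun i => ?_⟩
    apply Nat.sInf_le
    rw [Finset.mem_coe, mem_cyclotomicCoset hm hn]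
    refine ⟨j + i, ?_⟩
    rw [← hj, Nat.mod_mul_mod, pow_add, mul_assoc]
  · rintro ⟨hs, h⟩
    refine ⟨s, hs, le_antisymm ?_ ?_⟩
    · apply Nat.sInf_le
      rw [Finset.mem_coe, mem_cyclotomicCoset hm hn]
      exact ⟨0, by rw [pow_zero, mul_one, Nat.mod_eq_of_lt hs]⟩
    · refine le_csInf (hne s) fun b hb => ?_
      rw [Finset.mem_coe, mem_cyclotomicCoset hm hn] at hb
      obtain ⟨i, rfl⟩ := hb
      exact h i

/-- A residue is a coset leader iff its folded orbit never exceeds its starting point. -/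
lemma mem_minRep_iff_foldedOrbit {q m n s : ℕ} (hm : 0 < m) (hn : n = q ^ m + 1) :
    s ∈ minRep q n ↔ 2 * s ≤ n ∧ ∀ i, foldedOrbit q n s i ≤ n - 2 * s := by
  have hn0 : 0 < n := by omega
  rw [mem_minRep hm hn]
  have hpair : ∀ i, s * q ^ (i + m) % n + s * q ^ i % n = 0 ∨
      s * q ^ (i + m) % n + s * q ^ i % n = n := by
    intro i
    have h := @mul_pow_add_mod q m s i
    rw [← hn, Nat.add_mod] at h
    have h1 : s * q ^ (i + m) % n < n := Nat.mod_lt _ hn0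
    have h2 : s * q ^ i % n < n := Nat.mod_lt _ hn0
    obtain ⟨c, hc⟩ := Nat.dvd_of_mod_eq_zero h
    have hc2 : c < 2 := by
      by_contra hcon
      have := Nat.mul_le_mul_left n (not_lt.mp hcon)
      omega
    interval_cases c
    · left; omega
    · right; omega
  constructor
  · rintro ⟨hs, h⟩
    have h2 : 2 * s ≤ n := by
      have := hpair 0
      have := h (0 + m)
      rw [pow_zero, mul_one, Nat.mod_eq_of_lt hs] at *
      omega
    refine ⟨h2, fun i => ?_⟩
    unfold foldedOrbit
    have := hpair i
    have := h i
    have := h (i + m)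
    rw [abs_le]
    omega
  · rintro ⟨h2, h⟩
    refine ⟨by omega, fun i => ?_⟩
    have := h i
    unfold foldedOrbit at this
    rw [abs_le] at this
    omega

/-- If the folded orbit stays strictly below its starting point before the half period `m`, the
coset has the full size `2 * m`. -/
lemma card_cyclotomicCoset {q m n s : ℕ} (hm : 0 < m) (hn : n = q ^ m + 1) (hodd : Odd n)
    (hs0 : 0 < s) (hs : 2 * s ≤ n)
    (h : ∀ i, 0 < i → i < m → foldedOrbit q n s i < n - 2 * s) :
    (cyclotomicCoset q n s).card = 2 * m := by
  have hn0 : 0 < n := by omega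
  have hper : ∀ p, 0 < p → p < 2 * m → s * q ^ p % n ≠ s := by
    intro p hp hpm heq
    have hval : foldedOrbit q n s p = n - 2 * s := by
      unfold foldedOrbit
      rw [heq, abs_of_nonpos (by omega)]
      ring
    rcases lt_trichotomy p m with hlt | rfl | hgt
    · exact absurd hval (h p hp hlt).ne
    · have h0 := @mul_pow_add_mod q p s 0
      rw [← hn, Nat.add_mod, zero_add, heq, pow_zero, mul_one,
        Nat.mod_eq_of_lt (show s < n by omega)] at h0
      have := Nat.le_of_dvd (by omega) (Nat.dvd_of_mod_eq_zero h0)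
      obtain ⟨c, hc⟩ := hodd
      omega
    · have := h (p - m) (by omega) (by omega)
      have hadd := @foldedOrbit_add q m s (p - m)
      rw [← hn, Nat.sub_add_cancel hgt.le] at hadd
      omega
  have hone := pow_two_mul_mod hn
  have hunit : IsUnit (q : ZMod n) := IsUnit.of_pow_eq_one hone (by omega)
  have hinj : ∀ i j, i < j → j < 2 * m → s * q ^ i % n ≠ s * q ^ j % n := by
    intro i j hij hj heq
    apply hper (j - i) (by omega) (by omega)
    have h1 : ((s * q ^ i : ℕ) : ZMod n) = ((s * q ^ j : ℕ) : ZMod n) :=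
      (ZMod.natCast_eq_natCast_iff _ _ _).mpr heq
    have h2 : ((s * q ^ (j - i) : ℕ) : ZMod n) = ((s : ℕ) : ZMod n) := by
      apply (hunit.pow i).mul_right_cancel
      push_cast at h1 ⊢
      rw [h1, mul_assoc, ← pow_add, Nat.sub_add_cancel hij.le]
    have h3 := (ZMod.natCast_eq_natCast_iff _ _ _).mp h2
    rw [Nat.ModEq] at h3
    rw [h3, Nat.mod_eq_of_lt (by omega)]
  have hord : orderOf (q : ZMod n) = 2 * m := by
    apply le_antisymm (orderOf_le_of_pow_eq_one (by omega) hone)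
    by_contra hlt
    push Not at hlt
    have hpos : 0 < orderOf (q : ZMod n) :=
      orderOf_pos_iff.mpr (isOfFinOrder_iff_pow_eq_one.mpr ⟨2 * m, by omega, hone⟩)
    apply hper _ hpos hlt
    have h2 : ((s * q ^ orderOf (q : ZMod n) : ℕ) : ZMod n) = ((s : ℕ) : ZMod n) := by
      push_cast
      rw [pow_orderOf_eq_one, mul_one]
    have h3 := (ZMod.natCast_eq_natCast_iff _ _ _).mp h2
    rw [Nat.ModEq] at h3
    rw [h3, Nat.mod_eq_of_lt (by omega)]
  unfold cyclotomicCoset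
  rw [hord, Finset.card_image_of_injOn, Finset.card_range]
  intro i hi j hj heq
  simp only [Finset.coe_range, Set.mem_Iio] at hi hj
  rcases lt_trichotomy i j with hlt | rfl | hgt
  · exact absurd heq (hinj i j hlt hj)
  · rfl
  · exact absurd heq.symm (hinj j i hgt hi)

/-! ### The two-step map of the folded orbit -/

/-- One step keeping to the upper branch, followed by one on the lower branch. -/
lemma foldMap_two_step_upper {q N : ℤ} {y : ℕ → ℤ} (hq : 2 ≤ q) (hN : 0 < N)
    (hrec : ∀ i, q * y i < 2 * ((q ^ 2 + 1) * N) → y (i + 1) = |(q ^ 2 + 1) * N - q * y i|)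
    {i : ℕ} {v : ℤ} (hy : y i = (q + 1) * N + v) (h0 : 0 ≤ (q - 1) * N + q * v)
    (h1 : q ^ 2 * v ≤ (q + 1) * N) :
    y (i + 1) = (q - 1) * N + q * v ∧ y (i + 2) = (q + 1) * N - q ^ 2 * v := by
  have e1 : y (i + 1) = (q - 1) * N + q * v := by
    rw [hrec i, hy, abs_sub_comm, abs_of_nonneg] <;> rw [hy] at *
    · ring
    · linarith
    · by_contra hcon
      push Not at hcon
      have := mul_le_mul_of_nonneg_left hcon (show 0 ≤ q by linarith)
      have : 0 < N * (q - 1) := mul_pos hN (by linarith)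
      have : 0 < N * (q - 1) * (q * q) := by positivity
      nlinarith
  refine ⟨e1, ?_⟩
  have hb : q * y (i + 1) ≤ (q ^ 2 + 1) * N := by rw [e1]; linarith
  have hpos : 0 < (q ^ 2 + 1) * N := by positivity
  rw [hrec (i + 1) (by linarith), abs_of_nonneg (by linarith), e1]
  ring

/-- One step on the lower branch, followed by another one on the lower branch. -/
lemma foldMap_two_step_lower {q N : ℤ} {y : ℕ → ℤ} (hq : 2 ≤ q) (hN : 0 < N)
    (hrec : ∀ i, q * y i < 2 * ((q ^ 2 + 1) * N) → y (i + 1) = |(q ^ 2 + 1) * N - q * y i|)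
    {i : ℕ} {v : ℤ} (hy : y i = (q + 1) * N + v) (h0 : (q - 1) * N + q * v ≤ 0)
    (h1 : -((2 * q ^ 2 - q + 1) * N) ≤ q ^ 2 * v) :
    y (i + 1) = -((q - 1) * N + q * v) ∧
      y (i + 2) = (q + 1) * N + (2 * q * (q - 1) * N + q ^ 2 * v) := by
  have hpos : 0 < (q ^ 2 + 1) * N := by positivity
  have e1 : y (i + 1) = -((q - 1) * N + q * v) := by
    rw [hrec i, hy, abs_of_nonneg] <;> rw [hy] at *
    · ring
    · linarith
    · linarith
  refine ⟨e1, ?_⟩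
  have hb : q * y (i + 1) ≤ (q ^ 2 + 1) * N := by rw [e1]; linarith
  rw [hrec (i + 1) (by linarith), abs_of_nonneg (by linarith), e1]
  ring

/-- A folded orbit that is bounded by its starting point starts at or above the point
`(q + 1) * N` of period two. -/
lemma le_of_foldMap_le {q N : ℤ} {y : ℕ → ℤ} (hq : 2 ≤ q)
    (hdvd : ¬ q + 1 ∣ (q ^ 2 + 1) * N)
    (hrec : ∀ i, y (i + 1) = |(q ^ 2 + 1) * N - q * y i|) (hle : ∀ i, y i ≤ y 0) :
    (q + 1) * N ≤ y 0 := by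
  by_contra hlt
  push Not at hlt
  have h1 := hrec 0
  have h2 := hrec 1
  have l1 := hle 1
  have l2 := hle 2
  rw [zero_add] at h1
  rw [one_add_one_eq_two] at h2
  have b2 := le_abs_self ((q ^ 2 + 1) * N - q * y 1)
  rcases le_total (q * y 0) ((q ^ 2 + 1) * N) with hc | hc
  · rw [abs_of_nonneg (by linarith)] at h1
    apply hdvd
    refine ⟨y 0, le_antisymm (by linarith) ?_⟩
    have : (q - 1) * ((q + 1) * y 0) ≤ (q - 1) * ((q ^ 2 + 1) * N) := by
      rw [h1] at b2 h2
      nlinarith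
    exact le_of_mul_le_mul_left this (by linarith)
  · rw [abs_of_nonpos (by linarith)] at h1
    rw [h1] at b2 h2
    have := mul_lt_mul_of_pos_left hlt (show 0 < q ^ 2 + 1 by positivity)
    nlinarith

/-- Successive upper two-step moves multiply the deviation by `-q ^ 2`. -/
lemma foldMap_chain {q N w : ℤ} {K : ℕ} {y : ℕ → ℤ} (hq : 2 ≤ q) (hN : 0 < N)
    (hrec : ∀ i, q * y i < 2 * ((q ^ 2 + 1) * N) → y (i + 1) = |(q ^ 2 + 1) * N - q * y i|)
    (hw : 0 ≤ w) (hbound : q * (q ^ (4 * K) * w) ≤ 2 * (q - 1) * N)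
    (h4 : y 4 = (q + 1) * N - w) :
    (∀ j ≤ K, y (4 + 4 * j) = (q + 1) * N - q ^ (4 * j) * w) ∧
      ∀ i < 4 * K, q ^ 2 * (y (4 + i) - (q + 1) * N) ≤ q ^ (4 * K) * w := by
  have hq0 : 0 < q := by linarith
  have hqN : 0 < (q - 1) * N := mul_pos (by linarith) hN
  have hlast : ∀ j, j < K → q ^ 4 * (q ^ (4 * j) * w) ≤ q ^ (4 * K) * w := by
    intro j hj
    rw [← mul_assoc, ← pow_add]
    exact mul_le_mul_of_nonneg_right (pow_le_pow_right₀ (by linarith) (by omega)) hw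
  have step : ∀ j, j < K → y (4 + 4 * j) = (q + 1) * N - q ^ (4 * j) * w →
      y (5 + 4 * j) = (q - 1) * N - q * (q ^ (4 * j) * w) ∧
        y (6 + 4 * j) = (q + 1) * N + q ^ 2 * (q ^ (4 * j) * w) ∧
        y (7 + 4 * j) = (q - 1) * N + q ^ 3 * (q ^ (4 * j) * w) ∧
        y (8 + 4 * j) = (q + 1) * N - q ^ 4 * (q ^ (4 * j) * w) := by
    intro j hj hy
    have hl := mul_le_mul_of_nonneg_left (hlast j hj) hq0.le
    have hp : 0 ≤ q ^ (4 * j) * w := by positivity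
    generalize q ^ (4 * j) * w = p at *
    have hp1 : 0 ≤ q * p := by positivity
    have hp2 : q * p * 2 ≤ q * p * q ^ 4 :=
      mul_le_mul_of_nonneg_left (by nlinarith [sq_nonneg (q ^ 2 - 1)]) hp1
    have hp3 : 2 * (q ^ 4 * p) ≤ q * (q ^ 4 * p) :=
      mul_le_mul_of_nonneg_right hq (by positivity)
    obtain ⟨a1, a2⟩ := foldMap_two_step_upper hq hN hrec (i := 4 + 4 * j)
      (v := -p) (by rw [hy]; ring) (by linarith) (by
        have : 0 < (q + 1) * N := by positivity
        have : 0 ≤ q ^ 2 * p := by positivity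
        linarith)
    have a1' : y (5 + 4 * j) = (q - 1) * N - q * p := by
      rw [show 5 + 4 * j = 4 + 4 * j + 1 by ring, a1]; ring
    have a2' : y (6 + 4 * j) = (q + 1) * N + q ^ 2 * p := by
      rw [show 6 + 4 * j = 4 + 4 * j + 2 by ring, a2]; ring
    obtain ⟨b1, b2⟩ := foldMap_two_step_upper hq hN hrec (i := 6 + 4 * j)
      (v := q ^ 2 * p) a2' (by positivity) (by nlinarith)
    refine ⟨a1', a2', ?_, ?_⟩
    · rw [show 7 + 4 * j = 6 + 4 * j + 1 by ring, b1]; ring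
    · rw [show 8 + 4 * j = 6 + 4 * j + 2 by ring, b2]; ring
  have hmain : ∀ j ≤ K, y (4 + 4 * j) = (q + 1) * N - q ^ (4 * j) * w := by
    intro j
    induction j with
    | zero => intro _; simpa using h4
    | succ j ih =>
      intro hj
      have := (step j (by omega) (ih (by omega))).2.2.2
      rw [show 4 + 4 * (j + 1) = 8 + 4 * j by ring, this]
      ring
  refine ⟨hmain, fun i hi => ?_⟩
  have hj : i / 4 < K := by omega
  have h0 := hmain (i / 4) hj.le
  obtain ⟨h1, h2, h3, -⟩ := step (i / 4) hj h0
  have hl := hlast (i / 4) hj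
  have hp : 0 ≤ q ^ (4 * (i / 4)) * w := by positivity
  have hK : 0 ≤ q ^ (4 * K) * w := by positivity
  generalize q ^ (4 * (i / 4)) * w = p at *
  have hcases : 4 + i = 4 + 4 * (i / 4) ∨ 4 + i = 5 + 4 * (i / 4) ∨ 4 + i = 6 + 4 * (i / 4) ∨
      4 + i = 7 + 4 * (i / 4) := by omega
  rcases hcases with hc | hc | hc | hc <;> rw [hc]
  · rw [h0]
    have : 0 ≤ q ^ 2 * p := by positivity
    linarith
  · rw [h1]
    have : 0 ≤ q ^ 2 * (q * p) := by positivity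
    have : 0 ≤ q ^ 2 * N := by positivity
    linarith
  · rw [h2]; linarith
  · rw [h3]
    have := mul_le_mul_of_nonneg_left hl hq0.le
    have : (q - 1) * N ≤ q ^ 2 * N := mul_le_mul_of_nonneg_right (by nlinarith) hN.le
    linarith

/-- Numerical bounds on deviations `V ≤ 2 q⁵ (q - 1) L`. -/
lemma deviation_bounds {q L N V : ℤ} (hq : 2 ≤ q) (hL : 1 ≤ L)
    (hN : N = q ^ 8 * L - (q ^ 2 - 1) * (q ^ 4 + 1)) (hV : V ≤ 2 * q ^ 5 * (q - 1) * L) :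
    0 < N ∧ q ^ 2 * V ≤ (q + 1) * N ∧ q ^ 4 * V ≤ (2 * q ^ 2 - q + 1) * N ∧
      q ^ 4 * V - 2 * q * (q - 1) * N ≤ q ^ 2 * V ∧
      q ^ 4 * V - 2 * q * (q - 1) * N ≤ 2 * q * (q - 1) * ((q ^ 2 - 1) * (q ^ 4 + 1)) := by
  have h1 : q ^ 2 * V ≤ q ^ 2 * (2 * q ^ 5 * (q - 1) * L) :=
    mul_le_mul_of_nonneg_left hV (by positivity)
  have h2 : q ^ 4 * V ≤ q ^ 4 * (2 * q ^ 5 * (q - 1) * L) :=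
    mul_le_mul_of_nonneg_left hV (by positivity)
  have h3 : (q ^ 4 - q ^ 2) * V ≤ (q ^ 4 - q ^ 2) * (2 * q ^ 5 * (q - 1) * L) :=
    mul_le_mul_of_nonneg_left hV (by nlinarith [sq_nonneg q, sq_nonneg (q ^ 2)])
  obtain ⟨p, rfl⟩ := Int.le.dest hq
  obtain ⟨l, rfl⟩ := Int.le.dest hL
  subst hN
  refine ⟨?_, ?_, ?_, ?_, ?_⟩
  · rw [← sub_pos]; ring_nf; positivity
  · refine h1.trans ?_
    rw [← sub_nonneg]; ring_nf; positivity
  · refine h2.trans ?_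
    rw [← sub_nonneg]; ring_nf; positivity
  · suffices (((2 : ℤ) + p) ^ 4 - (2 + p) ^ 2) * (2 * (2 + p) ^ 5 * (2 + p - 1) * (1 + l)) ≤
      2 * (2 + p) * (2 + p - 1) * ((2 + p) ^ 8 * (1 + l) - ((2 + p) ^ 2 - 1) * ((2 + p) ^ 4 + 1)) by
        linarith
    rw [← sub_nonneg]; ring_nf; positivity
  · linarith

set_option maxHeartbeats 800000 in
/-- The starting points of folded orbits that are bounded by them, near the largest one. -/
lemma foldMap_classification {q L N V : ℤ} {K : ℕ} {y : ℕ → ℤ} (hq : 2 ≤ q) (hL : 1 ≤ L)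
    (hR : q ^ 2 * q ^ (4 * K) = (q ^ 2 + 1) * L - 1)
    (hN : N = q ^ 8 * L - (q ^ 2 - 1) * (q ^ 4 + 1))
    (hrec : ∀ i, y (i + 1) = |(q ^ 2 + 1) * N - q * y i|) (hle : ∀ i, y i ≤ y 0)
    (hper : y (4 * K + 10) = y 0) (hy0 : y 0 = (q + 1) * N + V) (hVe : Even V)
    (hV0 : 0 ≤ V) (hV : V ≤ 2 * q ^ 5 * (q - 1) * L) :
    V = 0 ∨ V = 2 * q * (q - 1) * (q ^ 4 * L - q ^ 2 + 1) ∨ V = 2 * q ^ 5 * (q - 1) * L := by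
  obtain ⟨hNpos, f1, f2, f3, f4⟩ := deviation_bounds hq hL hN hV
  have hrec' : ∀ i, q * y i < 2 * ((q ^ 2 + 1) * N) → y (i + 1) = |(q ^ 2 + 1) * N - q * y i| :=
    fun i _ => hrec i
  have hq0 : 0 < q := by linarith
  have hqN : 0 < (q - 1) * N := mul_pos (by linarith) hNpos
  obtain ⟨v, hv⟩ : ∃ v : ℕ → ℤ, ∀ i, y (2 * i) = (q + 1) * N + v i :=
    ⟨fun i => y (2 * i) - (q + 1) * N, fun i => by ring⟩
  have hv0 : v 0 = V := by have := hv 0; rw [mul_zero] at this; linarith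
  have hvV : ∀ i, v i ≤ V := fun i => by
    have := hle (2 * i)
    have := hv i
    linarith
  have hvQ : ∀ i, q ^ 2 * v i ≤ q ^ 2 * V := fun i =>
    mul_le_mul_of_nonneg_left (hvV i) (by positivity)
  have hA' : ∀ i, 0 ≤ (q - 1) * N + q * v i → v (i + 1) = -(q ^ 2 * v i) := by
    intro i h
    have := (foldMap_two_step_upper hq hNpos hrec' (hv i) h ((hvQ i).trans f1)).2
    have h2 := hv (i + 1)
    rw [show 2 * (i + 1) = 2 * i + 2 by ring] at h2
    linarith
  have hB' : ∀ i, -(q ^ 2 * V) ≤ v i → (q - 1) * N + q * v i ≤ 0 →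
      v (i + 1) = 2 * q * (q - 1) * N + q ^ 2 * v i := by
    intro i hi h
    have hi2 := mul_le_mul_of_nonneg_left hi (show 0 ≤ q ^ 2 by positivity)
    have := (foldMap_two_step_lower hq hNpos hrec' (hv i) h (by linarith)).2
    have h2 := hv (i + 1)
    rw [show 2 * (i + 1) = 2 * i + 2 by ring] at h2
    linarith
  have hlow : ∀ i, -(q ^ 2 * V) ≤ v i := by
    intro i
    induction i with
    | zero => rw [hv0]; have : 0 ≤ q ^ 2 * V := by positivity
              linarith
    | succ i ih =>
      rcases le_total 0 ((q - 1) * N + q * v i) with h | h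
      · rw [hA' i h]; linarith [hvQ i]
      · rw [hB' i ih h]
        have := mul_le_mul_of_nonneg_left ih (show 0 ≤ q ^ 2 by positivity)
        linarith
  have hB := fun i => hB' i (hlow i)
  have hApos : ∀ i, 0 ≤ v i → v (i + 1) = -(q ^ 2 * v i) := fun i h => hA' i (by positivity)
  rcases hV0.eq_or_lt with hV0 | hV0
  · exact Or.inl hV0.symm
  right
  have hQ1 : 1 < q ^ 2 := by nlinarith
  have hend : v (2 * K + 5) = V := by
    have := hv (2 * K + 5)
    rw [show 2 * (2 * K + 5) = 4 * K + 10 by ring] at this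
    linarith
  have hv1 : v 1 = -(q ^ 2 * V) := by
    have := hApos 0 (by rw [hv0]; exact hV0.le)
    rwa [hv0] at this
  rcases lt_or_ge (q ^ 4 * V - 2 * q * (q - 1) * N) 0 with hw | hw
  · exfalso
    have halt : ∀ i, 0 < v (2 * i) := by
      intro i
      induction i with
      | zero => rw [mul_zero, hv0]; exact hV0
      | succ i ih =>
        have h1 := hApos (2 * i) ih.le
        have hp : 0 < q ^ 2 * v (2 * i) := by positivity
        rw [show 2 * (i + 1) = 2 * i + 1 + 1 by ring]
        rcases le_total 0 ((q - 1) * N + q * v (2 * i + 1)) with h | h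
        · rw [hA' _ h, h1]
          have : 0 < q ^ 2 * (q ^ 2 * v (2 * i)) := by positivity
          linarith
        · rw [hB _ h]
          have := mul_le_mul_of_nonneg_left (hlow (2 * i + 1)) (show 0 ≤ q ^ 2 by positivity)
          linarith
    have h1 := halt (K + 2)
    have h2 := hApos _ h1.le
    rw [show 2 * (K + 2) + 1 = 2 * K + 5 by ring, hend] at h2
    have : 0 < q ^ 2 * v (2 * (K + 2)) := by positivity
    linarith
  obtain ⟨w, hwdef⟩ : ∃ w, w = q ^ 4 * V - 2 * q * (q - 1) * N := ⟨_, rfl⟩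
  rw [← hwdef] at hw f4
  have hv2 : v 2 = -w := by
    rcases le_total 0 ((q - 1) * N + q * v 1) with h | h
    · exfalso
      have h1 := hA' 1 h
      have h2 := hvV (1 + 1)
      rw [h1, hv1] at h2
      have : V < q ^ 2 * V := by nlinarith
      have : q ^ 2 * V < q ^ 2 * (q ^ 2 * V) := by nlinarith
      linarith
    · rw [hB 1 h, hv1, hwdef]; ring
  obtain ⟨R, hRdef⟩ : ∃ R : ℤ, R = q ^ (4 * K) := ⟨_, rfl⟩
  have hRpos : 0 < R := by rw [hRdef]; positivity
  rw [← hRdef] at hR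
  have hNR : N = q ^ 2 * R * ((q ^ 2 - 1) * (q ^ 4 + 1)) + L := by
    rw [hN, hR]; ring
  have hRw := mul_le_mul_of_nonneg_left f4 (show 0 ≤ q * R by positivity)
  have hqL : 0 < (q - 1) * L := mul_pos (by linarith) (by linarith)
  have hchain := (foldMap_chain (K := K) hq hNpos hrec' hw
    (by rw [← hRdef, hNR]; linarith) (by have := hv 2; rw [hv2] at this; linarith)).1 K le_rfl
  have hv3 : v (2 * K + 2) = -(R * w) := by
    have := hv (2 * K + 2)
    rw [show 2 * (2 * K + 2) = 4 + 4 * K by ring, hchain, ← hRdef] at this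
    linarith
  have hRw0 : 0 ≤ R * w := by positivity
  obtain ⟨u, hu⟩ : ∃ u, u = 2 * q ^ 5 * (q - 1) * L - V := ⟨_, rfl⟩
  have hVu : V = 2 * q ^ 5 * (q - 1) * L - u := by linarith
  have hwu : w = 2 * q * (q - 1) * ((q ^ 2 - 1) * (q ^ 4 + 1)) - q ^ 4 * u := by
    rw [hwdef, hVu, hN]; ring
  have hn : (q ^ 2 + 1) * N = q ^ 10 * R + 1 := by
    rw [hN]; linear_combination -q ^ 8 * hR
  have hlarge : ∀ t : ℤ, Even t → 0 < t → 2 * q * (q - 1) * N < t * (q ^ 10 * R - 1) := by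
    intro t ht ht0
    have ht2 : 2 ≤ t := by obtain ⟨c, rfl⟩ := ht; omega
    have h10 : 0 ≤ q ^ 10 * R - 1 := by
      have : 0 < q ^ 10 * R := by positivity
      omega
    have := mul_le_mul_of_nonneg_right ht2 h10
    have hN1' : 1 ≤ N := hNpos
    have hqN2 : 2 * N ≤ q * N := mul_le_mul_of_nonneg_right hq hNpos.le
    linarith
  rcases le_total 0 ((q - 1) * N + q * v (2 * K + 2)) with h | h
  · have e1 : v (2 * K + 3) = q ^ 2 * (R * w) := by rw [hA' _ h, hv3]; ring
    have e2 : v (2 * K + 4) = -(q ^ 4 * (R * w)) := by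
      rw [hApos _ (by rw [e1]; positivity), e1]; ring
    left
    rcases le_total 0 ((q - 1) * N + q * v (2 * K + 4)) with h' | h'
    · exfalso
      have e3 := hA' _ h'
      rw [hend, e2] at e3
      have hw0 : 0 < w := by
        refine hw.lt_of_ne fun h0 => ?_
        rw [← h0] at e3
        linarith
      have hwe : Even w := by
        rw [hwdef]
        exact (hVe.mul_left _).sub ⟨q * (q - 1) * N, by ring⟩
      have := hlarge w hwe hw0
      have e4 : 2 * q * (q - 1) * N = w * (q ^ 10 * R - 1) := by
        linear_combination hwdef + q ^ 4 * e3
      linarith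
    · have e3 := hB _ h'
      rw [hend, e2] at e3
      have e4 : (q ^ 2 + 1) * N * V =
          (q ^ 2 + 1) * N * (2 * q * (q - 1) * (q ^ 4 * L - q ^ 2 + 1)) := by
        rw [hwdef] at e3
        linear_combination V * hn + e3 + 2 * q * (q - 1) * N * q ^ 4 * hR
      exact mul_left_cancel₀ (by positivity) e4
  · have e1 : v (2 * K + 3) = 2 * q * (q - 1) * L + q ^ 6 * R * u := by
      rw [hB _ h, hv3, hwu, hNR]; ring
    have e1' : 0 ≤ v (2 * K + 3) := by
      have : 0 ≤ q ^ 6 * R * u := mul_nonneg (by positivity) (by linarith)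
      have : 0 < q * ((q - 1) * L) := by positivity
      linarith
    have e2 : v (2 * K + 4) = -(q ^ 2 * (2 * q * (q - 1) * L + q ^ 6 * R * u)) := by
      rw [hApos _ e1', e1]
    rcases le_total 0 ((q - 1) * N + q * v (2 * K + 4)) with h' | h'
    · right
      have e3 := hA' _ h'
      rw [hend, e2, hVu] at e3
      have hu0 : u * (q ^ 10 * R + 1) = 0 := by linear_combination -e3
      have : q ^ 10 * R + 1 ≠ 0 := by positivity
      have := (mul_eq_zero.mp hu0).resolve_right this
      linarith
    · exfalso
      have e3 := hB _ h'
      rw [hend, e2, hVu] at e3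
      have e4 : u * (q ^ 10 * R - 1) = 2 * q * (q - 1) * (N - 2 * q ^ 4 * L) := by
        linear_combination e3
      have hue : Even u := by
        rw [hu]
        exact Even.sub ⟨q ^ 5 * (q - 1) * L, by ring⟩ hVe
      have hqq : 0 < 2 * q * (q - 1) := mul_pos (by positivity) (by linarith)
      have hu0 : 0 ≤ u := by linarith
      rcases hu0.eq_or_lt with h0 | h0
      · rw [← h0, zero_mul] at e4
        have h5 := (mul_eq_zero.mp e4.symm).resolve_left hqq.ne'
        have h6 : 0 < N - 2 * q ^ 4 * L := by
          obtain ⟨p, rfl⟩ := Int.le.dest hq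
          obtain ⟨l, rfl⟩ := Int.le.dest hL
          rw [hN]; ring_nf; positivity
        linarith
      · have h5 := hlarge u hue h0
        rw [e4] at h5
        have : 0 ≤ 2 * q * (q - 1) * (2 * q ^ 4 * L) := by positivity
        linarith

/-- After an upper two-step move with nonpositive new deviation, both new points lie below a
starting point with positive deviation. -/
lemma foldMap_upper_lt {q N V : ℤ} {y : ℕ → ℤ} (hq : 2 ≤ q) (hN : 0 < N) (hV : 0 < V)
    (hrec : ∀ i, q * y i < 2 * ((q ^ 2 + 1) * N) → y (i + 1) = |(q ^ 2 + 1) * N - q * y i|)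
    {i : ℕ} {v : ℤ} (hy : y i = (q + 1) * N + v) (h0 : 0 ≤ (q - 1) * N + q * v)
    (h1 : q ^ 2 * v ≤ (q + 1) * N) :
    y (i + 1) < (q + 1) * N + V ∧ y (i + 2) = (q + 1) * N - q ^ 2 * v := by
  obtain ⟨e1, e2⟩ := foldMap_two_step_upper hq hN hrec hy h0 h1
  refine ⟨?_, e2⟩
  rw [e1]
  have : q * (q * v) < q * (2 * N) := by nlinarith
  have := lt_of_mul_lt_mul_left this (by linarith)
  linarith

lemma foldMap_lower_lt {q N V : ℤ} {y : ℕ → ℤ} (hq : 2 ≤ q) (hN : 0 < N) (hV : 0 < V)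
    (hrec : ∀ i, q * y i < 2 * ((q ^ 2 + 1) * N) → y (i + 1) = |(q ^ 2 + 1) * N - q * y i|)
    {i : ℕ} {v : ℤ} (hy : y i = (q + 1) * N + v) (h0 : (q - 1) * N + q * v ≤ 0)
    (h1 : -((2 * q ^ 2 - q + 1) * N) ≤ q ^ 2 * v) :
    y (i + 1) < (q + 1) * N + V ∧
      y (i + 2) = (q + 1) * N + (2 * q * (q - 1) * N + q ^ 2 * v) := by
  obtain ⟨e1, e2⟩ := foldMap_two_step_lower hq hN hrec hy h0 h1
  refine ⟨?_, e2⟩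
  rw [e1]
  have : q * (-(q * v)) < q * (2 * q * N) := by nlinarith
  have := lt_of_mul_lt_mul_left this (by linarith)
  linarith

/-- The common initial segment of the orbits of the second and third largest leaders. -/
lemma foldMap_initial_lt {q L N V w : ℤ} {K : ℕ} {y : ℕ → ℤ} (hq : 2 ≤ q) (hL : 1 ≤ L)
    (hR : q ^ 2 * q ^ (4 * K) = (q ^ 2 + 1) * L - 1)
    (hN : N = q ^ 8 * L - (q ^ 2 - 1) * (q ^ 4 + 1))
    (hrec : ∀ i, q * y i < 2 * ((q ^ 2 + 1) * N) → y (i + 1) = |(q ^ 2 + 1) * N - q * y i|)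
    (hy0 : y 0 = (q + 1) * N + V) (hV0 : 0 < V) (hV : V ≤ 2 * q ^ 5 * (q - 1) * L)
    (hwdef : w = q ^ 4 * V - 2 * q * (q - 1) * N) (hw : 0 ≤ w)
    (hwV : q ^ (4 * K) * w < q ^ 2 * V) :
    (∀ i, 0 < i → i < 4 * K + 5 → y i < y 0) ∧
      y (4 * K + 4) = (q + 1) * N - q ^ (4 * K) * w := by
  obtain ⟨hNpos, f1, f2, f3, f4⟩ := deviation_bounds hq hL hN hV
  have hq0 : 0 < q := by linarith
  have hqN : 0 < (q - 1) * N := mul_pos (by linarith) hNpos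
  obtain ⟨a1, a2⟩ := foldMap_upper_lt hq hNpos hV0 hrec hy0 (by positivity) f1
  obtain ⟨b1, b2⟩ := foldMap_lower_lt (v := -(q ^ 2 * V)) hq hNpos hV0 hrec (i := 2)
    (by rw [a2]; ring) (by
      have : 0 < q * ((q - 1) * N) := by positivity
      have : q * ((q - 1) * N) ≤ q * (q * (q ^ 2 * V)) := by linarith
      have := le_of_mul_le_mul_left this hq0
      linarith) (by linarith)
  have h4 : y 4 = (q + 1) * N - w := by rw [b2, hwdef]; ring
  obtain ⟨R, hRdef⟩ : ∃ R : ℤ, R = q ^ (4 * K) := ⟨_, rfl⟩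
  have hRpos : 0 < R := by rw [hRdef]; positivity
  have hNR : N = q ^ 2 * R * ((q ^ 2 - 1) * (q ^ 4 + 1)) + L := by
    rw [hN, hRdef, hR]; ring
  rw [← hwdef] at f4
  have hRw := mul_le_mul_of_nonneg_left f4 (show 0 ≤ q * R by positivity)
  have hqL : 0 < (q - 1) * L := mul_pos (by linarith) (by linarith)
  obtain ⟨c1, c2⟩ := foldMap_chain (K := K) hq hNpos hrec hw
    (by rw [← hRdef, hNR]; linarith) h4
  have hend : y (4 * K + 4) = (q + 1) * N - q ^ (4 * K) * w := by
    rw [add_comm, c1 K le_rfl]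
  refine ⟨fun i hi hiK => ?_, hend⟩
  have hcases : i = 1 ∨ i = 2 ∨ i = 3 ∨ i = 4 * K + 4 ∨ ∃ j < 4 * K, i = 4 + j := by
    by_cases h : i < 4
    · omega
    · by_cases h' : i = 4 * K + 4
      · omega
      · exact Or.inr (Or.inr (Or.inr (Or.inr ⟨i - 4, by omega, by omega⟩)))
  have hQV : 0 < q ^ 2 * V := by positivity
  rcases hcases with rfl | rfl | rfl | rfl | ⟨j, hj, rfl⟩
  · rw [hy0]; exact a1
  · rw [hy0]; rw [zero_add] at a2; rw [a2]; linarith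
  · rw [hy0]; exact b1
  · rw [hy0, hend]
    have : 0 ≤ q ^ (4 * K) * w := by positivity
    linarith
  · rw [hy0]
    have := (c2 j hj).trans_lt hwV
    have := lt_of_mul_lt_mul_left this (by positivity)
    linarith

lemma forall_lt_of_initial {y : ℕ → ℤ} {k : ℕ} (h : ∀ i, 0 < i → i < k + 5 → y i < y 0)
    (h5 : y (k + 5) < y 0) (h6 : y (k + 6) < y 0) (h7 : y (k + 7) < y 0) (h8 : y (k + 8) < y 0)
    (h9 : y (k + 9) < y 0) : ∀ i, 0 < i → i < k + 10 → y i < y 0 := by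
  intro i hi hik
  have hcases : i < k + 5 ∨ i = k + 5 ∨ i = k + 6 ∨ i = k + 7 ∨ i = k + 8 ∨ i = k + 9 := by omega
  rcases hcases with hc | rfl | rfl | rfl | rfl | rfl
  exacts [h i hi hc, h5, h6, h7, h8, h9]

lemma two_mul_pow_four_lt {q L N : ℤ} (hq : 2 ≤ q) (hL : 1 ≤ L)
    (hN : N = q ^ 8 * L - (q ^ 2 - 1) * (q ^ 4 + 1)) : 2 * q ^ 4 * L < N := by
  obtain ⟨p, rfl⟩ := Int.le.dest hq
  obtain ⟨l, rfl⟩ := Int.le.dest hL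
  rw [hN, ← sub_pos]
  ring_nf
  positivity

lemma foldMap_lt_second {q L N : ℤ} {K : ℕ} {y : ℕ → ℤ} (hq : 2 ≤ q) (hL : 1 ≤ L)
    (hR : q ^ 2 * q ^ (4 * K) = (q ^ 2 + 1) * L - 1)
    (hN : N = q ^ 8 * L - (q ^ 2 - 1) * (q ^ 4 + 1))
    (hrec : ∀ i, q * y i < 2 * ((q ^ 2 + 1) * N) → y (i + 1) = |(q ^ 2 + 1) * N - q * y i|)
    (hy0 : y 0 = (q + 1) * N + 2 * q * (q - 1) * (q ^ 4 * L - q ^ 2 + 1)) :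
    ∀ i, 0 < i → i < 4 * K + 10 → y i < y 0 := by
  have hq0 : 0 < q := by linarith
  have hq1 : 0 < q - 1 := by linarith
  have hQ1 : 0 < q ^ 2 - 1 := by nlinarith
  have hL4 : q ^ 4 ≤ q ^ 4 * L := by nlinarith [sq_nonneg (q ^ 2)]
  have hM : 0 < q ^ 4 * L - q ^ 2 + 1 := by nlinarith
  obtain ⟨V, hVdef⟩ : ∃ V, V = 2 * q * (q - 1) * (q ^ 4 * L - q ^ 2 + 1) := ⟨_, rfl⟩
  rw [← hVdef] at hy0
  have hV0 : 0 < V := by rw [hVdef]; positivity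
  have hV : V ≤ 2 * q ^ 5 * (q - 1) * L := by
    have : 0 < 2 * q * (q - 1) * (q ^ 2 - 1) := by positivity
    linarith
  obtain ⟨hNpos, f1, f2, f3, f4⟩ := deviation_bounds hq hL hN hV
  have hLN := two_mul_pow_four_lt hq hL hN
  have hX : q ^ 2 * (q ^ (4 * K) * (2 * q * (q - 1) * (q ^ 2 - 1))) =
      V - 2 * q * (q - 1) * L := by
    rw [hVdef]; linear_combination (2 * q * (q - 1) * (q ^ 2 - 1)) * hR
  have hX0 : 0 ≤ q ^ (4 * K) * (2 * q * (q - 1) * (q ^ 2 - 1)) := by positivity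
  have hL0 : 0 < 2 * q * (q - 1) * L := by positivity
  have hVV : V ≤ q ^ 2 * V := by nlinarith
  have hXV : q ^ (4 * K) * (2 * q * (q - 1) * (q ^ 2 - 1)) < q ^ 2 * V := by nlinarith
  obtain ⟨hini, h4⟩ := foldMap_initial_lt (K := K) (w := 2 * q * (q - 1) * (q ^ 2 - 1))
    hq hL hR hN hrec hy0 hV0 hV (by rw [hVdef, hN]; ring) (by positivity) hXV
  have hw : 0 < q ^ 4 * V - 2 * q * (q - 1) * N := by
    have : q ^ 4 * V - 2 * q * (q - 1) * N = 2 * q * (q - 1) * (q ^ 2 - 1) := by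
      rw [hVdef, hN]; ring
    rw [this]; positivity
  generalize q ^ (4 * K) * (2 * q * (q - 1) * (q ^ 2 - 1)) = X at *
  have hqN : 0 < (q - 1) * N := mul_pos (by linarith) hNpos
  obtain ⟨a1, a2⟩ := foldMap_upper_lt (v := -X) hq hNpos hV0 hrec (i := 4 * K + 4)
    (by rw [h4]; ring) (by
      have h1 : q * X * 2 ≤ q * X * q := mul_le_mul_of_nonneg_left hq (by positivity)
      have h2 : q ^ 2 * (q ^ 2 * X) ≤ q ^ 2 * V :=
        mul_le_mul_of_nonneg_left (by linarith) (by positivity)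
      have h3 : q ^ 3 * (q * X) ≤ q ^ 3 * ((q - 1) * N) := by
        have : (q + 1) * N ≤ q ^ 3 * (q - 1) * N := mul_le_mul_of_nonneg_right (by
          obtain ⟨p, rfl⟩ := Int.le.dest hq
          rw [← sub_nonneg]; ring_nf; positivity) hNpos.le
        linarith
      have := le_of_mul_le_mul_left h3 (by positivity)
      linarith) (by
      have : 0 ≤ q ^ 2 * X := by positivity
      have : 0 < (q + 1) * N := by positivity
      linarith)
  have hQV : q ^ 2 * (q ^ 2 * X) ≤ q ^ 2 * V :=
    mul_le_mul_of_nonneg_left (by linarith) (by positivity)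
  obtain ⟨b1, b2⟩ := foldMap_upper_lt (v := q ^ 2 * X) hq hNpos hV0 hrec (i := 4 * K + 6)
    (by rw [a2]; ring) (by positivity) (by linarith)
  obtain ⟨c1, -⟩ := foldMap_lower_lt (v := -(q ^ 2 * (q ^ 2 * X))) hq hNpos hV0 hrec
    (i := 4 * K + 8) (by rw [b2]; ring) (by
      rw [hX]
      have h2 : q * ((q - 1) * N) ≤ q * (q * (q ^ 2 * (V - 2 * q * (q - 1) * L))) := by
        have := mul_lt_mul_of_pos_left hLN (show 0 < q * (q - 1) by positivity)
        linarith
      have := le_of_mul_le_mul_left h2 hq0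
      linarith) (by
      have := mul_le_mul_of_nonneg_left hQV (show 0 ≤ q ^ 2 by positivity)
      linarith)
  rw [← hy0] at a1 b1 c1
  refine forall_lt_of_initial hini a1 ?_ b1 ?_ c1
  · rw [hy0, show 4 * K + 6 = 4 * K + 4 + 2 by ring, a2]
    linarith
  · rw [hy0, show 4 * K + 8 = 4 * K + 6 + 2 by ring, b2]
    have : 0 ≤ q ^ 2 * (q ^ 2 * X) := by positivity
    linarith

lemma foldMap_lt_third {q L N : ℤ} {K : ℕ} {y : ℕ → ℤ} (hq : 2 ≤ q) (hL : 1 ≤ L)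
    (hR : q ^ 2 * q ^ (4 * K) = (q ^ 2 + 1) * L - 1)
    (hN : N = q ^ 8 * L - (q ^ 2 - 1) * (q ^ 4 + 1))
    (hrec : ∀ i, q * y i < 2 * ((q ^ 2 + 1) * N) → y (i + 1) = |(q ^ 2 + 1) * N - q * y i|)
    (hy0 : y 0 = (q + 1) * N + 2 * q ^ 5 * (q - 1) * L) :
    ∀ i, 0 < i → i < 4 * K + 10 → y i < y 0 := by
  have hq0 : 0 < q := by linarith
  have hq1 : 0 < q - 1 := by linarith
  have hQ1 : 0 < q ^ 2 - 1 := by nlinarith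
  obtain ⟨V, hVdef⟩ : ∃ V, V = 2 * q ^ 5 * (q - 1) * L := ⟨_, rfl⟩
  rw [← hVdef] at hy0
  have hV0 : 0 < V := by rw [hVdef]; positivity
  obtain ⟨hNpos, f1, f2, f3, f4⟩ := deviation_bounds hq hL hN hVdef.le
  have hLN := two_mul_pow_four_lt hq hL hN
  have hLL : L ≤ q ^ 4 * L := by
    have : 1 ≤ q ^ 4 := one_le_pow₀ (by linarith)
    nlinarith
  have hX : q ^ 2 * (q ^ (4 * K) * (2 * q * (q - 1) * ((q ^ 2 - 1) * (q ^ 4 + 1)))) =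
      2 * q * (q - 1) * (N - L) := by
    rw [hN]; linear_combination (2 * q * (q - 1) * ((q ^ 2 - 1) * (q ^ 4 + 1))) * hR
  have hG : 0 < 2 * q * (q - 1) * ((q ^ 2 - 1) * (q ^ 4 + 1)) := by positivity
  have hL0 : 0 < 2 * q * (q - 1) * L := by positivity
  have hqN : 0 < (q - 1) * N := mul_pos (by linarith) hNpos
  have hw : 2 * q * (q - 1) * ((q ^ 2 - 1) * (q ^ 4 + 1)) = q ^ 4 * V - 2 * q * (q - 1) * N := by
    rw [hVdef, hN]; ring
  have hXV : q ^ (4 * K) * (2 * q * (q - 1) * ((q ^ 2 - 1) * (q ^ 4 + 1))) < q ^ 2 * V := by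
    have : q ^ 2 * (q ^ (4 * K) * (2 * q * (q - 1) * ((q ^ 2 - 1) * (q ^ 4 + 1)))) <
        q ^ 2 * (q ^ 2 * V) := by
      rw [hX]; linarith
    exact lt_of_mul_lt_mul_left this (by positivity)
  obtain ⟨hini, h4⟩ := foldMap_initial_lt (K := K)
    hq hL hR hN hrec hy0 hV0 hVdef.le hw hG.le hXV
  have hX0 : 0 ≤ q ^ (4 * K) * (2 * q * (q - 1) * ((q ^ 2 - 1) * (q ^ 4 + 1))) := by positivity
  generalize q ^ (4 * K) * (2 * q * (q - 1) * ((q ^ 2 - 1) * (q ^ 4 + 1))) = X at *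
  have hLV : 2 * q * (q - 1) * L < V := by
    have : 1 < q ^ 4 := one_lt_pow₀ (by linarith) (by norm_num)
    have := mul_lt_mul_of_pos_left this hL0
    rw [hVdef]
    linarith
  obtain ⟨a1, a2⟩ := foldMap_lower_lt (v := -X) hq hNpos hV0 hrec (i := 4 * K + 4)
    (by rw [h4]; ring) (by
      have h1 : q * ((q - 1) * N) ≤ q * (q * X) := by
        have := mul_le_mul_of_nonneg_left (show 2 * L ≤ N by linarith)
          (show 0 ≤ q * (q - 1) by positivity)
        linarith
      have := le_of_mul_le_mul_left h1 hq0
      linarith) (by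
      have : 0 < (q + 1) * N := by positivity
      linarith)
  have a2' : y (4 * K + 6) = (q + 1) * N + 2 * q * (q - 1) * L := by
    rw [show 4 * K + 6 = 4 * K + 4 + 2 by ring, a2]
    linear_combination -hX
  have hQL : q ^ 2 * (2 * q * (q - 1) * L) ≤ q ^ 2 * V :=
    mul_le_mul_of_nonneg_left hLV.le (by positivity)
  obtain ⟨b1, b2⟩ := foldMap_upper_lt hq hNpos hV0 hrec a2' (by positivity) (by linarith)
  obtain ⟨c1, -⟩ := foldMap_upper_lt (v := -(q ^ 2 * (2 * q * (q - 1) * L))) hq hNpos hV0 hrec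
    (i := 4 * K + 8) (by rw [b2]; ring) (by
      have := mul_lt_mul_of_pos_left hLN hq1
      linarith) (by
      have : 0 < (q + 1) * N := by positivity
      have : 0 < q ^ 2 * (q ^ 2 * (2 * q * (q - 1) * L)) := by positivity
      linarith)
  rw [← hy0] at a1 b1 c1
  refine forall_lt_of_initial hini a1 ?_ b1 ?_ c1
  · rw [hy0, a2']
    linarith
  · rw [hy0, show 4 * K + 8 = 4 * K + 6 + 2 by ring, b2]
    have : 0 ≤ q ^ 2 * (2 * q * (q - 1) * L) := by positivity
    linarith

/-- The point `(q + 1) * N` has period two and is the larger point of its orbit. -/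
lemma foldMap_le_first {q N : ℤ} {y : ℕ → ℤ} (hq : 2 ≤ q) (hN : 0 < N)
    (hrec : ∀ i, q * y i < 2 * ((q ^ 2 + 1) * N) → y (i + 1) = |(q ^ 2 + 1) * N - q * y i|)
    (hy0 : y 0 = (q + 1) * N) : ∀ i, y i ≤ y 0 := by
  have hqN : 0 < (q - 1) * N := mul_pos (by linarith) hN
  have hqN' : 0 < (q + 1) * N := mul_pos (by linarith) hN
  have hpair : ∀ j, y (2 * j) = (q + 1) * N ∧ y (2 * j + 1) = (q - 1) * N := by
    have hstep : ∀ j, y (2 * j) = (q + 1) * N →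
        y (2 * j + 1) = (q - 1) * N ∧ y (2 * j + 2) = (q + 1) * N := by
      intro j hj
      have := foldMap_two_step_upper (v := 0) hq hN hrec (i := 2 * j) (by rw [hj]; ring)
        (by linarith) (by linarith)
      simpa using this
    intro j
    induction j with
    | zero => exact ⟨hy0, (hstep 0 hy0).1⟩
    | succ j ih => exact ⟨(hstep j ih.1).2, (hstep (j + 1) (hstep j ih.1).2).1⟩
  intro i
  rcases Nat.even_or_odd' i with ⟨j, rfl | rfl⟩
  · rw [(hpair j).1, hy0]
  · rw [(hpair j).2, hy0]; linarith

/-! ### The case of half period six -/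

lemma foldMap_classification_six {q V : ℤ} {y : ℕ → ℤ} (hq : 2 ≤ q)
    (hrec : ∀ i, y (i + 1) = |(q ^ 6 + 1) - q * y i|) (hle : ∀ i, y i ≤ y 0)
    (hy0 : y 0 = (q + 1) * (q ^ 4 - q ^ 2 + 1) + V) (hVe : Even V)
    (hV0 : 0 ≤ V) (hV : V ≤ 2 * q * (q ^ 2 - 1)) :
    V = 0 ∨ V = 2 * q * (q - 1) ∨ V = 2 * q * (q ^ 2 - 1) := by
  obtain ⟨V, rfl⟩ := hVe
  rcases hV0.eq_or_lt with h0 | hV0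
  · exact Or.inl h0.symm
  right
  have hq0 : 0 < q := by linarith
  have q3 : 0 < q ^ 3 - 1 := by
    have : 1 < q ^ 3 := one_lt_pow₀ (by linarith) (by norm_num)
    linarith
  have q5 : 0 < q ^ 5 - 1 := by
    have : 1 < q ^ 5 := one_lt_pow₀ (by linarith) (by norm_num)
    linarith
  have hqV : 0 < q * V := by nlinarith
  have e1 : y 1 = (q - 1) * (q ^ 4 - q ^ 2 + 1) + q * (V + V) := by
    rw [hrec 0, hy0, abs_sub_comm, abs_of_nonneg]
    · ring
    · have : 0 ≤ q ^ 5 - q ^ 4 - q ^ 3 + q ^ 2 + q - 1 := by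
        obtain ⟨p, rfl⟩ := Int.le.dest hq
        ring_nf; positivity
      linarith
  rcases le_total ((q + 1) * (q ^ 4 - q ^ 2 + 1)) (q ^ 2 * (V + V)) with h2 | h2
  · right
    have e2 : y 2 = q ^ 2 * (V + V) - (q + 1) * (q ^ 4 - q ^ 2 + 1) := by
      rw [hrec 1, e1, abs_of_nonpos]
      · ring
      · linarith
    have l3 := hle 3
    have b3 := le_abs_self (q ^ 6 + 1 - q * y 2)
    rw [← hrec 2, e2] at b3
    by_contra hne
    have hlt : V ≤ q * (q ^ 2 - 1) - 1 := by
      have : V + V < 2 * q * (q ^ 2 - 1) := lt_of_le_of_ne hV hne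
      have : V < q * (q ^ 2 - 1) := by linarith
      linarith
    have := mul_le_mul_of_nonneg_left hlt (show 0 ≤ q ^ 3 + 1 by positivity)
    have : 0 < q ^ 2 := by positivity
    linarith
  left
  have e2 : y 2 = (q + 1) * (q ^ 4 - q ^ 2 + 1) - q ^ 2 * (V + V) := by
    rw [hrec 1, e1, abs_of_nonneg]
    · ring
    · linarith
  rcases le_total (q ^ 3 * (V + V)) ((q - 1) * (q ^ 4 - q ^ 2 + 1)) with h3 | h3
  · exfalso
    have e3 : y 3 = (q - 1) * (q ^ 4 - q ^ 2 + 1) - q ^ 3 * (V + V) := by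
      rw [hrec 2, e2, abs_sub_comm, abs_of_nonneg]
      · ring
      · linarith
    have l4 := hle 4
    have b4 := le_abs_self (q ^ 6 + 1 - q * y 3)
    rw [← hrec 3, e3] at b4
    have : 1 < q ^ 4 := one_lt_pow₀ (by linarith) (by norm_num)
    nlinarith
  have e3 : y 3 = q ^ 3 * (V + V) - (q - 1) * (q ^ 4 - q ^ 2 + 1) := by
    rw [hrec 2, e2, abs_of_nonneg]
    · ring
    · linarith
  have l3 := hle 3
  have hup : V ≤ q ^ 2 - 1 := by
    by_contra hcon
    have hcon : q ^ 2 ≤ V := by linarith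
    have := mul_le_mul_of_nonneg_left hcon q3.le
    have : q ^ 2 + q < q ^ 3 := by
      obtain ⟨p, rfl⟩ := Int.le.dest hq
      rw [← sub_pos]; ring_nf; positivity
    linarith
  have l5 := hle 5
  rcases le_total (q ^ 4 * (V + V)) ((2 * q ^ 2 - q + 1) * (q ^ 4 - q ^ 2 + 1)) with h4 | h4
  · have e4 : y 4 = (2 * q ^ 2 - q + 1) * (q ^ 4 - q ^ 2 + 1) - q ^ 4 * (V + V) := by
      rw [hrec 3, e3, abs_of_nonneg]
      · ring
      · linarith
    have l4 := hle 4
    have b5 := le_abs_self (q ^ 6 + 1 - q * y 4)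
    rw [← hrec 4, e4] at b5
    have hlo : q * (q - 1) ≤ V := by
      by_contra hcon
      have hcon : V ≤ q * (q - 1) - 1 := by linarith
      have := mul_le_mul_of_nonneg_left hcon (show 0 ≤ q ^ 4 + 1 by positivity)
      have : 0 < q ^ 3 := by positivity
      linarith
    have hhi : V ≤ q * (q - 1) := by
      by_contra hcon
      have hcon : q * (q - 1) + 1 ≤ V := by linarith
      have := mul_le_mul_of_nonneg_left hcon q5.le
      have : 0 < (q ^ 2 - q + 1) * (q ^ 3 - q - 1) := by
        obtain ⟨p, rfl⟩ := Int.le.dest hq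
        ring_nf; positivity
      linarith
    linarith
  · exfalso
    have e4 : y 4 = q ^ 4 * (V + V) - (2 * q ^ 2 - q + 1) * (q ^ 4 - q ^ 2 + 1) := by
      rw [hrec 3, e3, abs_of_nonpos]
      · ring
      · linarith
    have b5 := le_abs_self (q ^ 6 + 1 - q * y 4)
    rw [← hrec 4, e4] at b5
    have := mul_le_mul_of_nonneg_left hup (show 0 ≤ q ^ 5 + 1 by positivity)
    have : q ^ 2 < q ^ 3 := pow_lt_pow_right₀ (by linarith) (by norm_num)
    linarith

lemma foldMap_lt_second_six {q : ℤ} {y : ℕ → ℤ} (hq : 2 ≤ q)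
    (hrec : ∀ i, q * y i < 2 * (q ^ 6 + 1) → y (i + 1) = |(q ^ 6 + 1) - q * y i|)
    (hy0 : y 0 = (q + 1) * (q ^ 4 - q ^ 2 + 1) + 2 * q * (q - 1)) :
    ∀ i, 0 < i → i < 6 → y i < y 0 := by
  have hn : (q ^ 2 + 1) * (q ^ 4 - q ^ 2 + 1) = q ^ 6 + 1 := by ring
  rw [← hn] at hrec
  have hN : 0 < q ^ 4 - q ^ 2 + 1 := by nlinarith [sq_nonneg (q ^ 2 - 1), sq_nonneg q]
  have hq1 : 0 < q - 1 := by linarith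
  have hV0 : 0 < 2 * q * (q - 1) := by positivity
  have hQ1 : 0 < q ^ 2 - 1 := by nlinarith
  obtain ⟨a1, a2⟩ := foldMap_upper_lt hq hN hV0 hrec hy0 (by positivity) (by
    obtain ⟨p, rfl⟩ := Int.le.dest hq
    rw [← sub_nonneg]; ring_nf; positivity)
  obtain ⟨b1, b2⟩ := foldMap_lower_lt (v := -(q ^ 2 * (2 * q * (q - 1)))) hq hN hV0 hrec (i := 2)
    (by rw [a2]; ring) (by
    obtain ⟨p, rfl⟩ := Int.le.dest hq
    rw [← sub_nonneg]; ring_nf; positivity) (by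
    obtain ⟨p, rfl⟩ := Int.le.dest hq
    rw [← sub_nonneg]; ring_nf; positivity)
  have b2' : y 4 = (q + 1) * (q ^ 4 - q ^ 2 + 1) + -(2 * q * (q - 1) * (q ^ 2 - 1)) := by
    rw [b2]; ring
  obtain ⟨c1, -⟩ := foldMap_lower_lt hq hN hV0 hrec b2' (by
    obtain ⟨p, rfl⟩ := Int.le.dest hq
    rw [← sub_nonneg]; ring_nf; positivity) (by
    obtain ⟨p, rfl⟩ := Int.le.dest hq
    rw [← sub_nonneg]; ring_nf; positivity)
  rw [← hy0] at a1 b1 c1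
  intro i hi hi6
  interval_cases i
  · exact a1
  · rw [hy0]
    rw [zero_add] at a2
    rw [a2]
    have : 0 < q ^ 2 * (2 * q * (q - 1)) := by positivity
    linarith
  · exact b1
  · rw [hy0, b2']
    have : 0 < 2 * q * (q - 1) * (q ^ 2 - 1) := by positivity
    linarith
  · exact c1

lemma foldMap_lt_third_six {q : ℤ} {y : ℕ → ℤ} (hq : 2 ≤ q)
    (hrec : ∀ i, q * y i < 2 * (q ^ 6 + 1) → y (i + 1) = |(q ^ 6 + 1) - q * y i|)
    (hy0 : y 0 = (q + 1) * (q ^ 4 - q ^ 2 + 1) + 2 * q * (q ^ 2 - 1)) :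
    ∀ i, 0 < i → i < 6 → y i < y 0 := by
  obtain ⟨p, rfl⟩ := Int.le.dest hq
  generalize hqdef : (2 : ℤ) + p = q at *
  have hup : ∀ {i : ℕ} {a : ℤ}, y i = a → q * a < 2 * (q ^ 6 + 1) → q ^ 6 + 1 ≤ q * a →
      y (i + 1) = q * a - (q ^ 6 + 1) := by
    intro i a h h1 h2
    rw [hrec i (by rw [h]; exact h1), h, abs_sub_comm, abs_of_nonneg (by linarith)]
  have hdown : ∀ {i : ℕ} {a : ℤ}, y i = a → q * a ≤ q ^ 6 + 1 →
      y (i + 1) = (q ^ 6 + 1) - q * a := by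
    intro i a h h1
    have : 0 < q ^ 6 + 1 := by rw [← hqdef]; positivity
    rw [hrec i (by rw [h]; linarith), h, abs_of_nonneg (by linarith)]
  have e1 := hup hy0 (by rw [← hqdef, ← sub_pos]; ring_nf; positivity)
    (by rw [← hqdef, ← sub_nonneg]; ring_nf; positivity)
  have e2 := hup e1 (by rw [← hqdef, ← sub_pos]; ring_nf; positivity)
    (by rw [← hqdef, ← sub_nonneg]; ring_nf; positivity)
  have e3 := hdown e2 (by rw [← hqdef, ← sub_nonneg]; ring_nf; positivity)
  have e4 := hup e3 (by rw [← hqdef, ← sub_pos]; ring_nf; positivity)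
    (by rw [← hqdef, ← sub_nonneg]; ring_nf; positivity)
  have e5 := hdown e4 (by rw [← hqdef, ← sub_nonneg]; ring_nf; positivity)
  intro i hi hi6
  rw [hy0]
  interval_cases i
  · rw [e1, ← hqdef, ← sub_pos]; ring_nf; positivity
  · rw [e2, ← hqdef, ← sub_pos]; ring_nf; positivity
  · rw [e3, ← hqdef, ← sub_pos]; ring_nf; positivity
  · rw [e4, ← hqdef, ← sub_pos]; ring_nf; positivity
  · rw [e5, ← hqdef, ← sub_pos]; ring_nf; positivity

/-- Three numbers `c < b < a` that are the only coset leaders from `c` on are, in this order, the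
third, second and first largest. -/
lemma isNthLargestCosetLeader_of_top {q n a b c : ℕ} (ha : a ∈ minRep q n) (hb : b ∈ minRep q n)
    (hc : c ∈ minRep q n) (hab : b < a) (hbc : c < b)
    (htop : ∀ s ∈ minRep q n, c ≤ s → s = a ∨ s = b ∨ s = c) :
    IsNthLargestCosetLeader q n 2 b ∧ IsNthLargestCosetLeader q n 3 c := by
  have h2 : (minRep q n).filter (fun s => b < s) = {a} := by
    ext s
    simp only [Finset.mem_filter, Finset.mem_singleton]
    constructor
    · rintro ⟨hs, hlt⟩
      have := htop s hs (by omega)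
      omega
    · rintro rfl; exact ⟨ha, hab⟩
  have h3 : (minRep q n).filter (fun s => c < s) = {a, b} := by
    ext s
    simp only [Finset.mem_filter, Finset.mem_insert, Finset.mem_singleton]
    constructor
    · rintro ⟨hs, hlt⟩
      have := htop s hs (by omega)
      omega
    · rintro (rfl | rfl)
      exacts [⟨ha, by omega⟩, ⟨hb, hbc⟩]
  refine ⟨⟨hb, ?_⟩, ⟨hc, ?_⟩⟩
  · rw [h2, Finset.card_singleton]
  · rw [h3, Finset.card_pair (show a ≠ b by omega)]

/-- A folded orbit strictly below its starting point gives a leader of a full-size coset. -/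
lemma mem_minRep_and_card {q m n s : ℕ} (hm : 0 < m) (hn : n = q ^ m + 1) (hodd : Odd n)
    (hs0 : 0 < s) (hs : 2 * s ≤ n)
    (h : ∀ i, 0 < i → i < m → foldedOrbit q n s i < foldedOrbit q n s 0) :
    s ∈ minRep q n ∧ (cyclotomicCoset q n s).card = 2 * m := by
  have hn0 : 0 < n := by omega
  rw [foldedOrbit_zero hs hn0] at h
  refine ⟨(mem_minRep_iff_foldedOrbit hm hn).mpr ⟨hs, fun i => ?_⟩,
    card_cyclotomicCoset hm hn hodd hs0 hs h⟩
  have hmod : ∀ k j, foldedOrbit q n s (j + k * m) = foldedOrbit q n s j := by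
    intro k j
    induction k with
    | zero => simp
    | succ k ih =>
      rw [show j + (k + 1) * m = j + k * m + m by ring, ← ih, hn, foldedOrbit_add]
  have hi : i = i % m + i / m * m := (Nat.mod_add_div' i m).symm
  rw [hi, hmod]
  rcases Nat.eq_zero_or_pos (i % m) with h0 | h0
  · rw [h0, foldedOrbit_zero hs hn0]
  · exact (h _ h0 (Nat.mod_lt _ hm)).le

/-- The folded orbit of a coset leader `s` follows the fold map, provided `s` is not too small. -/
lemma foldedOrbit_of_mem_minRep {q m n s : ℕ} (hm : 0 < m) (hn : n = q ^ m + 1) (hq : Even q)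
    (hs : s ∈ minRep q n) (hlarge : (q : ℤ) * (n - 2 * s) < 2 * n) :
    foldedOrbit q n s 0 = n - 2 * s ∧ (∀ i, foldedOrbit q n s i ≤ foldedOrbit q n s 0) ∧
      (∀ i, foldedOrbit q n s (i + 1) = |(n : ℤ) - q * foldedOrbit q n s i|) ∧
      foldedOrbit q n s m = foldedOrbit q n s 0 := by
  have hn0 : 0 < n := by omega
  obtain ⟨h2, hle⟩ := (mem_minRep_iff_foldedOrbit hm hn).mp hs
  have h0 := foldedOrbit_zero (q := q) h2 hn0
  refine ⟨h0, fun i => by rw [h0]; exact hle i, fun i => foldedOrbit_succ hq hn0 ?_, ?_⟩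
  · exact (mul_le_mul_of_nonneg_left (hle i) (by positivity)).trans_lt hlarge
  · have := @foldedOrbit_add q m s 0
    rwa [← hn, zero_add] at this

lemma not_succ_dvd_pow_add_one {q m : ℕ} (hq : 2 ≤ q) (hm : Even m) :
    ¬ (q : ℤ) + 1 ∣ (q : ℤ) ^ m + 1 := by
  intro h
  have h1 : (q : ℤ) + 1 ∣ (q : ℤ) ^ m - 1 := by
    have := sub_dvd_pow_sub_pow ((q : ℤ)) (-1) m
    rwa [hm.neg_one_pow, sub_neg_eq_add] at this
  have h2 := dvd_sub h h1
  have := Int.le_of_dvd (by norm_num) h2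
  omega

/-- Assembles the conclusion from the fold-map description of the three largest leaders, whose
deviations from the centre are `(q + 1) N`, `(q + 1) N + V₂` and `(q + 1) N + V₃`. -/
lemma top_three_of_foldMap {q m n : ℕ} {N V₂ V₃ : ℤ} (hq : 2 ≤ q) (hqe : Even q) (hm0 : 0 < m)
    (hm : Even m) (hn : n = q ^ m + 1) (hnN : (n : ℤ) = ((q : ℤ) ^ 2 + 1) * N) (hN : 0 < N)
    (hV₂ : 0 < V₂) (hV₂e : Even V₂) (hV₂₃ : V₂ < V₃) (hV₃e : Even V₃)
    (hVN : V₃ < ((q : ℤ) ^ 2 - q) * N) (hVq : (q : ℤ) * ((q + 1) * N + V₃) < 2 * n)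
    (hlt : ∀ V, V = V₂ ∨ V = V₃ → ∀ y : ℕ → ℤ, y 0 = (q + 1) * N + V →
      (∀ i, (q : ℤ) * y i < 2 * n → y (i + 1) = |(n : ℤ) - q * y i|) →
      ∀ i, 0 < i → i < m → y i < y 0)
    (hclass : ∀ V, 0 ≤ V → V ≤ V₃ → Even V → ∀ y : ℕ → ℤ, y 0 = (q + 1) * N + V →
      (∀ i, y (i + 1) = |(n : ℤ) - q * y i|) → (∀ i, y i ≤ y 0) → y m = y 0 →
      V = 0 ∨ V = V₂ ∨ V = V₃) :
    ∃ δ₂ δ₃ : ℕ, 2 * (δ₂ : ℤ) = ((q : ℤ) ^ 2 - q) * N - V₂ ∧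
      2 * (δ₃ : ℤ) = ((q : ℤ) ^ 2 - q) * N - V₃ ∧
      IsNthLargestCosetLeader q n 2 δ₂ ∧ IsNthLargestCosetLeader q n 3 δ₃ ∧
      (cyclotomicCoset q n δ₂).card = 2 * m ∧ (cyclotomicCoset q n δ₃).card = 2 * m := by
  have hq' : (2 : ℤ) ≤ q := by exact_mod_cast hq
  have hn0 : 0 < n := by omega
  have hodd : Odd n := by rw [hn]; exact (hqe.pow_of_ne_zero hm0.ne').add_one
  have hoddZ : Odd (n : ℤ) := by exact_mod_cast hodd
  have hNodd : Odd N := (Int.odd_mul.mp (hnN ▸ hoddZ)).2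
  have hqeZ : Even (q : ℤ) := by exact_mod_cast hqe
  have hexists : ∀ V, Even V → V < ((q : ℤ) ^ 2 - q) * N →
      ∃ δ : ℕ, 2 * (δ : ℤ) = ((q : ℤ) ^ 2 - q) * N - V := by
    intro V hVe hVlt
    have he : Even (((q : ℤ) ^ 2 - q) * N - V) :=
      (Even.mul_right ((hqeZ.pow_of_ne_zero two_ne_zero).sub hqeZ) N).sub hVe
    obtain ⟨d, hd⟩ := he
    refine ⟨d.toNat, ?_⟩
    rw [Int.toNat_of_nonneg (by linarith)]
    linarith
  have hqN : 0 < ((q : ℤ) + 1) * N := by positivity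
  obtain ⟨δ₁, h₁⟩ := hexists 0 Even.zero (by linarith)
  obtain ⟨δ₂, h₂⟩ := hexists V₂ hV₂e (by linarith)
  obtain ⟨δ₃, h₃⟩ := hexists V₃ hV₃e hVN
  have hrec : ∀ s i, (q : ℤ) * foldedOrbit q n s i < 2 * n →
      foldedOrbit q n s (i + 1) = |(n : ℤ) - q * foldedOrbit q n s i| :=
    fun s i => foldedOrbit_succ hqe hn0
  have hfull : ∀ V δ, (V = V₂ ∨ V = V₃) → 2 * ((δ : ℕ) : ℤ) = ((q : ℤ) ^ 2 - q) * N - V →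
      δ ∈ minRep q n ∧ (cyclotomicCoset q n δ).card = 2 * m := by
    intro V δ hV hδ
    have hVb : 0 < V ∧ V ≤ V₃ := by rcases hV with rfl | rfl <;> constructor <;> linarith
    have h2 : 2 * δ ≤ n := by zify; linarith
    refine mem_minRep_and_card hm0 hn hodd ?_ h2 (hlt V hV _ ?_ (hrec δ))
    · zify; linarith
    · rw [foldedOrbit_zero h2 hn0]; linarith
  obtain ⟨m₂, c₂⟩ := hfull V₂ δ₂ (Or.inl rfl) h₂
  obtain ⟨m₃, c₃⟩ := hfull V₃ δ₃ (Or.inr rfl) h₃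
  have m₁ : δ₁ ∈ minRep q n := by
    have h2 : 2 * δ₁ ≤ n := by zify; linarith
    have h0 : foldedOrbit q n δ₁ 0 = (q + 1) * N := by
      rw [foldedOrbit_zero h2 hn0]; linarith
    refine (mem_minRep_iff_foldedOrbit hm0 hn).mpr ⟨h2, fun i => ?_⟩
    rw [← foldedOrbit_zero (q := q) h2 hn0]
    refine foldMap_le_first hq' hN ?_ h0 i
    rw [← hnN]
    exact hrec δ₁
  obtain ⟨n₂, n₃⟩ := isNthLargestCosetLeader_of_top m₁ m₂ m₃ (by zify; linarith)
    (by zify; linarith) (by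
      intro s hs hsle
      zify at hsle
      obtain ⟨V, hV⟩ : ∃ V, V = ((q : ℤ) ^ 2 - q) * N - 2 * s := ⟨_, rfl⟩
      have hV₃ : V ≤ V₃ := by linarith
      have hns : (n : ℤ) - 2 * s = (q + 1) * N + V := by rw [hnN, hV]; ring
      obtain ⟨h0, hle, hr, hper⟩ := foldedOrbit_of_mem_minRep hm0 hn hqe hs (by
        rw [hns]
        have := mul_le_mul_of_nonneg_left hV₃ (show (0 : ℤ) ≤ q by positivity)
        linarith)
      rw [hns] at h0
      have hV0 : 0 ≤ V := by
        have := le_of_foldMap_le hq' (N := N) (y := foldedOrbit q n s) (by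
          rw [← hnN, hn]; push_cast; exact not_succ_dvd_pow_add_one hq hm)
          (by rw [← hnN]; exact hr) hle
        linarith
      have hVe : Even V := by
        rw [hV]
        exact (Even.mul_right ((hqeZ.pow_of_ne_zero two_ne_zero).sub hqeZ) N).sub (even_two_mul _)
      rcases hclass V hV0 hV₃ hVe _ h0 hr hle hper with h | h | h
      · left; zify; linarith
      · right; left; zify; linarith
      · right; right; zify; linarith)
  exact ⟨δ₂, δ₃, h₂, h₃, n₂, n₃, c₂, c₃⟩

theorem lemma7 (q m n : ℕ) (hq : IsPrimePow q) (hq2 : Even q) (hm : m % 4 = 2) (hm6 : 6 ≤ m)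
    (hn : n = q ^ m + 1) :
    ∃ δ₂ δ₃ : ℕ,
      (δ₂ : ℚ) = (q : ℚ) * (q - 1) * ((q : ℚ) ^ m - 2 * (q : ℚ) ^ (m - 4) - 1)
        / (2 * ((q : ℚ) ^ 2 + 1)) ∧
      (δ₃ : ℚ) = (if m = 6 then (δ₂ : ℚ) - ((q : ℚ) - 1) * (q : ℚ) ^ 2
        else (δ₂ : ℚ) - (q : ℚ) * (q - 1) * ((q : ℚ) ^ 2 - 1)) ∧
      IsNthLargestCosetLeader q n 2 δ₂ ∧
      IsNthLargestCosetLeader q n 3 δ₃ ∧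
      (cyclotomicCoset q n δ₂).card = 2 * m ∧
      (cyclotomicCoset q n δ₃).card = 2 * m := by
  have hq1 : 2 ≤ q := hq.two_le
  have hq' : (2 : ℤ) ≤ q := by exact_mod_cast hq1
  have hpos : (2 * ((q : ℚ) ^ 2 + 1)) ≠ 0 := by positivity
  have hqm1 : (0 : ℤ) < q - 1 := by linarith
  have hQm1 : (0 : ℤ) < (q : ℤ) ^ 2 - 1 := by nlinarith
  by_cases h6 : m = 6
  · subst h6
    have hnZ : (n : ℤ) = (q : ℤ) ^ 6 + 1 := by rw [hn]; push_cast; ring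
    have hnN : (n : ℤ) = ((q : ℤ) ^ 2 + 1) * ((q : ℤ) ^ 4 - q ^ 2 + 1) := by rw [hnZ]; ring
    obtain ⟨p, hp⟩ := Int.le.dest hq'
    obtain ⟨δ₂, δ₃, h₂, h₃, hrest⟩ := top_three_of_foldMap (V₂ := 2 * q * (q - 1))
      (V₃ := 2 * q * ((q : ℤ) ^ 2 - 1)) hq1 hq2 (by norm_num) (by decide) hn hnN
      (by rw [← hp]; ring_nf; positivity) (by positivity) ⟨q * (q - 1), by ring⟩
      (by rw [← hp, ← sub_pos]; ring_nf; positivity) ⟨q * ((q : ℤ) ^ 2 - 1), by ring⟩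
      (by rw [← hp, ← sub_pos]; ring_nf; positivity)
      (by rw [hnZ, ← hp, ← sub_pos]; ring_nf; positivity)
      (by
        rw [hnZ]
        rintro V (rfl | rfl) y hy0 hrec
        · exact foldMap_lt_second_six hq' hrec hy0
        · exact foldMap_lt_third_six hq' hrec hy0)
      (by
        rw [hnZ]
        intro V hV0 hV hVe y hy0 hrec hle _
        exact foldMap_classification_six hq' hrec hle hy0 hVe hV0 hV)
    have h₂Q : 2 * (δ₂ : ℚ) =
        ((q : ℚ) ^ 2 - q) * ((q : ℚ) ^ 4 - q ^ 2 + 1) - 2 * q * (q - 1) := by exact_mod_cast h₂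
    have h₃Q : 2 * (δ₃ : ℚ) =
        ((q : ℚ) ^ 2 - q) * ((q : ℚ) ^ 4 - q ^ 2 + 1) - 2 * q * ((q : ℚ) ^ 2 - 1) := by
      exact_mod_cast h₃
    refine ⟨δ₂, δ₃, ?_, ?_, hrest⟩
    · rw [eq_div_iff hpos]
      linear_combination ((q : ℚ) ^ 2 + 1) * h₂Q
    · rw [if_pos rfl]
      linear_combination (h₃Q - h₂Q) / 2
  · obtain ⟨K, rfl⟩ : ∃ K, m = 4 * K + 10 := ⟨(m - 10) / 4, by omega⟩
    obtain ⟨L, hL⟩ : (q : ℤ) ^ 2 + 1 ∣ ((q : ℤ) ^ 2) ^ (2 * K + 1) + 1 := by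
      have := Odd.add_dvd_pow_add_pow ((q : ℤ) ^ 2) 1 (n := 2 * K + 1) ⟨K, rfl⟩
      rwa [one_pow] at this
    have hR : (q : ℤ) ^ 2 * (q : ℤ) ^ (4 * K) = ((q : ℤ) ^ 2 + 1) * L - 1 := by
      rw [← hL]; ring
    have hL1 : 1 ≤ L := by
      have : 0 < ((q : ℤ) ^ 2 + 1) * L := by rw [← hL]; positivity
      have := (mul_pos_iff_of_pos_left (show 0 < (q : ℤ) ^ 2 + 1 by positivity)).mp this
      omega
    obtain ⟨N, hN⟩ : ∃ N : ℤ, N = (q : ℤ) ^ 8 * L - ((q : ℤ) ^ 2 - 1) * ((q : ℤ) ^ 4 + 1) :=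
      ⟨_, rfl⟩
    have hnN : (n : ℤ) = ((q : ℤ) ^ 2 + 1) * N := by
      rw [hn, hN]; push_cast
      linear_combination (q : ℤ) ^ 8 * hR
    obtain ⟨hNpos, f1, -, -, -⟩ := deviation_bounds hq' hL1 hN le_rfl
    have hLN := two_mul_pow_four_lt hq' hL1 hN
    have hL4 : (q : ℤ) ^ 4 ≤ (q : ℤ) ^ 4 * L := le_mul_of_one_le_right (by positivity) hL1
    have hM : 0 < (q : ℤ) ^ 4 * L - (q : ℤ) ^ 2 + 1 := by nlinarith
    obtain ⟨δ₂, δ₃, h₂, h₃, hrest⟩ := top_three_of_foldMap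
      (V₂ := 2 * q * (q - 1) * ((q : ℤ) ^ 4 * L - (q : ℤ) ^ 2 + 1))
      (V₃ := 2 * (q : ℤ) ^ 5 * (q - 1) * L) hq1 hq2 (by omega) ⟨2 * K + 5, by ring⟩ hn hnN hNpos
      (by positivity) ⟨q * (q - 1) * ((q : ℤ) ^ 4 * L - (q : ℤ) ^ 2 + 1), by ring⟩
      (by
        have : 0 < 2 * (q : ℤ) * (q - 1) * ((q : ℤ) ^ 2 - 1) := by positivity
        linarith) ⟨(q : ℤ) ^ 5 * (q - 1) * L, by ring⟩
      (by
        have := mul_lt_mul_of_pos_left hLN (show 0 < (q : ℤ) * (q - 1) by positivity)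
        linarith)
      (by
        rw [hnN]
        have h1 : (q : ℤ) * (q * (2 * (q : ℤ) ^ 5 * (q - 1) * L)) <
            q * (((q : ℤ) ^ 2 - q + 2) * N) := by
          have : ((q : ℤ) + 1) * N < q * ((q : ℤ) ^ 2 - q + 2) * N :=
            mul_lt_mul_of_pos_right (by nlinarith [mul_pos hqm1 hqm1]) hNpos
          linarith
        have := lt_of_mul_lt_mul_left h1 (by positivity)
        linarith)
      (by
        rw [hnN]
        rintro V (rfl | rfl) y hy0 hrec
        · exact foldMap_lt_second hq' hL1 hR hN hrec hy0
        · exact foldMap_lt_third hq' hL1 hR hN hrec hy0)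
      (by
        rw [hnN]
        intro V hV0 hV hVe y hy0 hrec hle hper
        exact foldMap_classification hq' hL1 hR hN hrec hle hper hy0 hVe hV0 hV)
    have h₂Q : 2 * (δ₂ : ℚ) = ((q : ℚ) ^ 2 - q) * N -
        2 * q * (q - 1) * ((q : ℚ) ^ 4 * L - (q : ℚ) ^ 2 + 1) := by exact_mod_cast h₂
    have h₃Q : 2 * (δ₃ : ℚ) = ((q : ℚ) ^ 2 - q) * N - 2 * (q : ℚ) ^ 5 * (q - 1) * L := by
      exact_mod_cast h₃
    have hRQ : (q : ℚ) ^ 2 * (q : ℚ) ^ (4 * K) = ((q : ℚ) ^ 2 + 1) * L - 1 := by exact_mod_cast hR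
    have hNQ : (N : ℚ) = (q : ℚ) ^ 8 * L - ((q : ℚ) ^ 2 - 1) * ((q : ℚ) ^ 4 + 1) := by
      exact_mod_cast hN
    refine ⟨δ₂, δ₃, ?_, ?_, hrest⟩
    · rw [eq_div_iff hpos, show 4 * K + 10 - 4 = 4 * K + 6 by omega]
      linear_combination ((q : ℚ) ^ 2 + 1) * h₂Q + ((q : ℚ) ^ 2 + 1) * ((q : ℚ) ^ 2 - q) * hNQ -
        (q : ℚ) * (q - 1) * ((q : ℚ) ^ 8 - 2 * (q : ℚ) ^ 4) * hRQ
    · rw [if_neg h6]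
      linear_combination (h₃Q - h₂Q) / 2
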